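/- Let $\Omega\subset\mathbb{R}^d$ be a bounded smooth domain, let $F\colon\partial\Omega\to\mathbb{R}$ be Lipschitz, and let the obstacle $\Psi\colon\overline\Omega\to\mathbb{R}$ be continuous, with $\sup_{\partial\Omega}\Psi<\inf_{\partial\Omega}F$. For $1<p<\infty$ let $u_p$ be the minimizer of $\int_\Omega|Dv|^p\,dx$ among all $v\in W^{1,p}(\Omega)$ with trace $F$ on $\partial\Omega$ and $v\ge\Psi$ in $\Omega$. Let $u_\infty$ be a limit of $(u_p)$ along some sequence of exponents tending to $\infty$ (for which the $u_p$ are taken in their continuous representatives on $\overline\Omega$), uniformly on $\overline\Omega$ and weakly in $W^{1,q}(\Omega)$ for every $1<q<\infty$. For $y\in\partial\Omega$ and $b=(b_1,b_2)\in\mathbb{R}^2$ with $b_1\ge 0$ put $K_y^b(x)=b_1|x-y|+b_2$; let $\mathcal{K}$ be the family of all such cones that satisfy $K_y^b\ge F$ on $\partial\Omega$ and $K_y^b\ge\Psi$ in $\Omega$, and let $$K_\infty(x)=\inf_{\mathcal{K}}K_y^b(x),\qquad x\in\overline\Omega.$$ Assume that $\Psi$ is differentiable in $\Omega$ and that $u_\infty=K_\infty$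 on $\overline\Omega$. Then $u_\infty$ is differentiable at every free boundary point $x_0\in\partial\{u_\infty=\Psi\}$, and $Du_\infty(x_0)=D\Psi(x_0)$. -/

import Mathlib

open MeasureTheory Filter Topology
open scoped ContDiff NNReal

noncomputable section

namespace ObstacleLimit

/-- A bounded smooth domain of `ℝ^d`: a nonempty, connected, bounded open set which near each of
its boundary points is the sublevel set `{ρ < 0}` of a smooth function with nonzero differential. -/
structure IsBoundedSmoothDomain {d : ℕ} (Ω : Set (EuclideanSpace ℝ (Fin d))) : Prop where
  isOpen : IsOpen Ω
  isConnected : IsConnected Ω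
  isBounded : Bornology.IsBounded Ω
  smooth_boundary : ∀ x ∈ frontier Ω, ∃ (U : Set (EuclideanSpace ℝ (Fin d)))
    (ρ : EuclideanSpace ℝ (Fin d) → ℝ), IsOpen U ∧ x ∈ U ∧ ContDiffOn ℝ ∞ ρ U ∧
      ρ x = 0 ∧ fderiv ℝ ρ x ≠ 0 ∧ ∀ y ∈ U, y ∈ Ω ↔ ρ y < 0

/-- `g` is the weak gradient of `v` in the open set `Ω`. -/
def IsWeakGradient {d : ℕ} (Ω : Set (EuclideanSpace ℝ (Fin d)))
    (v : EuclideanSpace ℝ (Fin d) → ℝ)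
    (g : EuclideanSpace ℝ (Fin d) → EuclideanSpace ℝ (Fin d)) : Prop :=
  LocallyIntegrableOn v Ω ∧ LocallyIntegrableOn g Ω ∧
    ∀ φ : EuclideanSpace ℝ (Fin d) → ℝ, ContDiff ℝ ∞ φ → HasCompactSupport φ → tsupport φ ⊆ Ω →
      ∫ x in Ω, v x • gradient φ x = -∫ x in Ω, φ x • g x

/-- `v` belongs to the Sobolev space `W^{1,p}(Ω)` and `g` is its weak gradient. -/
def MemSobolev {d : ℕ} (Ω : Set (EuclideanSpace ℝ (Fin d))) (p : ℝ)
    (v : EuclideanSpace ℝ (Fin d) → ℝ)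
    (g : EuclideanSpace ℝ (Fin d) → EuclideanSpace ℝ (Fin d)) : Prop :=
  MemLp v (ENNReal.ofReal p) (volume.restrict Ω) ∧
    MemLp g (ENNReal.ofReal p) (volume.restrict Ω) ∧ IsWeakGradient Ω v g

/-- The Sobolev function `v ∈ W^{1,p}(Ω)`, with weak gradient `g`, has trace `F` on `∂Ω`: it is the
limit in `W^{1,p}(Ω)` of functions smooth up to the boundary whose boundary values converge to `F`
in `L^p(∂Ω)` with respect to the surface measure (the `(d-1)`-dimensional Hausdorff measure). -/
def HasTrace {d : ℕ} (Ω : Set (EuclideanSpace ℝ (Fin d))) (p : ℝ)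
    (v : EuclideanSpace ℝ (Fin d) → ℝ)
    (g : EuclideanSpace ℝ (Fin d) → EuclideanSpace ℝ (Fin d))
    (F : EuclideanSpace ℝ (Fin d) → ℝ) : Prop :=
  ∃ φ : ℕ → EuclideanSpace ℝ (Fin d) → ℝ, (∀ n, ContDiff ℝ ∞ (φ n)) ∧
    Tendsto (fun n => eLpNorm (fun x => φ n x - v x) (ENNReal.ofReal p) (volume.restrict Ω))
      atTop (𝓝 0) ∧
    Tendsto (fun n => eLpNorm (fun x => gradient (φ n) x - g x) (ENNReal.ofReal p)
      (volume.restrict Ω)) atTop (𝓝 0) ∧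
    Tendsto (fun n => eLpNorm (fun x => φ n x - F x) (ENNReal.ofReal p)
      ((Measure.hausdorffMeasure ((d : ℝ) - 1)).restrict (frontier Ω))) atTop (𝓝 0)

/-- The competitors of the `p`-obstacle problem: `v ∈ W^{1,p}(Ω)` (with weak gradient `g`), with
trace `F` on `∂Ω` and `v ≥ Ψ` in `Ω`. -/
def IsCompetitor {d : ℕ} (Ω : Set (EuclideanSpace ℝ (Fin d)))
    (F Ψ : EuclideanSpace ℝ (Fin d) → ℝ) (p : ℝ) (v : EuclideanSpace ℝ (Fin d) → ℝ)
    (g : EuclideanSpace ℝ (Fin d) → EuclideanSpace ℝ (Fin d)) : Prop :=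
  MemSobolev Ω p v g ∧ HasTrace Ω p v g F ∧ ∀ᵐ x ∂(volume.restrict Ω), Ψ x ≤ v x

/-- `u` (with weak gradient `g`) minimizes `∫_Ω |Dv|^p` among the competitors of the `p`-obstacle
problem. -/
def IsMinimizer {d : ℕ} (Ω : Set (EuclideanSpace ℝ (Fin d)))
    (F Ψ : EuclideanSpace ℝ (Fin d) → ℝ) (p : ℝ) (u : EuclideanSpace ℝ (Fin d) → ℝ)
    (g : EuclideanSpace ℝ (Fin d) → EuclideanSpace ℝ (Fin d)) : Prop :=
  IsCompetitor Ω F Ψ p u g ∧ ∀ v h, IsCompetitor Ω F Ψ p v h →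
    ∫ x in Ω, ‖g x‖ ^ p ≤ ∫ x in Ω, ‖h x‖ ^ p

/-- Weak convergence in `W^{1,q}(Ω)` of `u n` (with weak gradients `g n`) to `w` (with weak
gradient `G`), where `r` is the conjugate exponent of `q`: the functions and their gradients
converge weakly in `L^q(Ω)`. -/
def TendstoWeakly {d : ℕ} (Ω : Set (EuclideanSpace ℝ (Fin d))) (r : ℝ)
    (u : ℕ → EuclideanSpace ℝ (Fin d) → ℝ)
    (g : ℕ → EuclideanSpace ℝ (Fin d) → EuclideanSpace ℝ (Fin d))
    (w : EuclideanSpace ℝ (Fin d) → ℝ)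
    (G : EuclideanSpace ℝ (Fin d) → EuclideanSpace ℝ (Fin d)) : Prop :=
  (∀ h : EuclideanSpace ℝ (Fin d) → ℝ, MemLp h (ENNReal.ofReal r) (volume.restrict Ω) →
    Tendsto (fun n => ∫ x in Ω, u n x * h x) atTop (𝓝 (∫ x in Ω, w x * h x))) ∧
  ∀ H : EuclideanSpace ℝ (Fin d) → EuclideanSpace ℝ (Fin d),
    MemLp H (ENNReal.ofReal r) (volume.restrict Ω) →
    Tendsto (fun n => ∫ x in Ω, inner ℝ (g n x) (H x)) atTop (𝓝 (∫ x in Ω, inner ℝ (G x) (H x)))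

/-- `w` is a limit `u_∞` of the `p`-obstacle problems: for some exponents `p n → ∞`, the (continuous
representatives of the) minimizers `u n` of the `p n`-obstacle problems converge to `w`, uniformly
on the compact set `closure Ω` and weakly in `W^{1,q}(Ω)` for every `1 < q < ∞`. -/
def IsObstacleLimit {d : ℕ} (Ω : Set (EuclideanSpace ℝ (Fin d)))
    (F Ψ : EuclideanSpace ℝ (Fin d) → ℝ) (w : EuclideanSpace ℝ (Fin d) → ℝ) : Prop :=
  ∃ (p : ℕ → ℝ) (u : ℕ → EuclideanSpace ℝ (Fin d) → ℝ)
    (g : ℕ → EuclideanSpace ℝ (Fin d) → EuclideanSpace ℝ (Fin d))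
    (G : EuclideanSpace ℝ (Fin d) → EuclideanSpace ℝ (Fin d)),
    (∀ n, 1 < p n) ∧ Tendsto p atTop atTop ∧
    (∀ n, IsMinimizer Ω F Ψ (p n) (u n) (g n)) ∧
    (∀ n, ContinuousOn (u n) (closure Ω)) ∧
    TendstoUniformlyOn u w atTop (closure Ω) ∧
    ∀ q r : ℝ, q.HolderConjugate r → MemSobolev Ω q w G ∧ TendstoWeakly Ω r u g w G

/-- The cone `b₁ |x - y| + b₂` with vertex at `y`. -/
def cone {d : ℕ} (y : EuclideanSpace ℝ (Fin d)) (b : ℝ × ℝ) (x : EuclideanSpace ℝ (Fin d)) : ℝ :=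
  b.1 * ‖x - y‖ + b.2

/-- The parameters `(y, b)` of the cones with vertex `y ∈ ∂Ω` and opening `b₁ ≥ 0` which lie above
`F` on `∂Ω` and above `Ψ` in `Ω`. -/
def coneFamily {d : ℕ} (Ω : Set (EuclideanSpace ℝ (Fin d)))
    (F Ψ : EuclideanSpace ℝ (Fin d) → ℝ) : Set (EuclideanSpace ℝ (Fin d) × (ℝ × ℝ)) :=
  {k | k.1 ∈ frontier Ω ∧ 0 ≤ k.2.1 ∧ (∀ x ∈ frontier Ω, F x ≤ cone k.1 k.2 x) ∧
    ∀ x ∈ Ω, Ψ x ≤ cone k.1 k.2 x}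

/-- The function `K_∞`, the infimum of the cones of the family `coneFamily Ω F Ψ`. -/
def coneInf {d : ℕ} (Ω : Set (EuclideanSpace ℝ (Fin d)))
    (F Ψ : EuclideanSpace ℝ (Fin d) → ℝ) (x : EuclideanSpace ℝ (Fin d)) : ℝ :=
  sInf ((fun k => cone k.1 k.2 x) '' coneFamily Ω F Ψ)

end ObstacleLimit

end

namespace ObstacleLimit

/-! The separation of `Ψ` and `F` on the boundary forces `u > Ψ` there, so every free boundary point
is interior. At such a point `Ψ` touches `u` from below. A cone has second differences of order `‖h‖
^ 2` away from its vertex, and all vertices lie on `∂Ω`; the openings of nearly optimal cones being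
bounded, this passes to the infimum (`coneInf_add_coneInf_le`). Semiconcavity plus touching from
below gives differentiability (`hasFDerivAt_of_touching_below`). -/

/-- A function which is touched from below by a differentiable function, and whose symmetric second
differences at the contact point are bounded above by a multiple of `‖h‖ ^ 2`, is differentiable
there, with the same derivative. -/
theorem hasFDerivAt_of_touching_below {E : Type*} [NormedAddCommGroup E] [NormedSpace ℝ E]
    {u f : E → ℝ} {A : E →L[ℝ] ℝ} {x₀ : E} {C : ℝ} (hf : HasFDerivAt f A x₀)
    (hx₀ : u x₀ = f x₀) (hle : ∀ᶠ x in 𝓝 x₀, f x ≤ u x)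
    (hsec : ∀ᶠ h in 𝓝 (0 : E), u (x₀ + h) + u (x₀ - h) ≤ 2 * u x₀ + C * ‖h‖ ^ 2) :
    HasFDerivAt u A x₀ := by
  rw [hasFDerivAt_iff_isLittleO_nhds_zero] at hf ⊢
  rw [Asymptotics.isLittleO_iff] at hf ⊢
  intro c hc
  have hneg : Tendsto (fun h : E => -h) (𝓝 0) (𝓝 0) := by
    simpa using (continuous_neg (G := E)).tendsto 0
  have hadd : Tendsto (fun h : E => x₀ + h) (𝓝 0) (𝓝 x₀) := by
    simpa using (by fun_prop : Continuous fun h : E => x₀ + h).tendsto 0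
  have hsmall : ∀ᶠ h in 𝓝 (0 : E), |C| * ‖h‖ < c / 2 := by
    have h0 : Tendsto (fun h : E => |C| * ‖h‖) (𝓝 0) (𝓝 0) := by
      simpa using (by fun_prop : Continuous fun h : E => |C| * ‖h‖).tendsto 0
    exact h0.eventually_lt_const (by positivity)
  have hfc := hf (half_pos hc)
  filter_upwards [hfc, hneg.eventually hfc, hadd.eventually hle,
    (hadd.comp hneg).eventually hle, hsec, hsmall] with h h1 h2 h3 h4 h5 h6
  simp only [Real.norm_eq_abs, norm_neg, map_neg, Function.comp_apply, ← sub_eq_add_neg] at *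
  have h7 : C * ‖h‖ ^ 2 ≤ c / 2 * ‖h‖ := by
    calc C * ‖h‖ ^ 2 ≤ |C| * ‖h‖ ^ 2 := by gcongr; exact le_abs_self C
      _ = |C| * ‖h‖ * ‖h‖ := by ring
      _ ≤ c / 2 * ‖h‖ := by gcongr
  have hn := norm_nonneg h
  have h1' := abs_le.1 h1
  have h2' := abs_le.1 h2
  rw [abs_le]
  -- The lower bound is touching at `x₀ + h`; the upper one combines the second difference bound
  -- with touching at `x₀ - h`.
  constructor <;> nlinarith

/-- By the parallelogram law the square of the left side is at most `4‖a‖² + 4‖h‖²`, the first two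
terms of the square of the right side. -/
theorem norm_add_add_norm_sub_le {E : Type*} [NormedAddCommGroup E] [InnerProductSpace ℝ E]
    {a : E} (ha : a ≠ 0) (h : E) :
    ‖a + h‖ + ‖a - h‖ ≤ 2 * ‖a‖ + ‖h‖ ^ 2 / ‖a‖ := by
  have hpos : 0 < ‖a‖ := norm_pos_iff.2 ha
  have hpar := parallelogram_law_with_norm ℝ a h
  have hq : ‖a‖ * (‖h‖ ^ 2 / ‖a‖) = ‖h‖ ^ 2 := by field_simp
  have hq0 : 0 ≤ ‖h‖ ^ 2 / ‖a‖ := by positivity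
  apply le_of_sq_le_sq _ (by positivity)
  nlinarith [sq_nonneg (‖a + h‖ - ‖a - h‖), sq_nonneg (‖h‖ ^ 2 / ‖a‖)]

variable {d : ℕ} {Ω : Set (EuclideanSpace ℝ (Fin d))} {F Ψ : EuclideanSpace ℝ (Fin d) → ℝ}

theorem cone_add_cone_le {y x h : EuclideanSpace ℝ (Fin d)} {b : ℝ × ℝ} {r : ℝ} (hb : 0 ≤ b.1)
    (hr : 0 < r) (hxy : r ≤ ‖x - y‖) :
    cone y b (x + h) + cone y b (x - h) ≤ 2 * cone y b x + b.1 / r * ‖h‖ ^ 2 := by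
  have hne : x - y ≠ 0 := norm_pos_iff.1 (hr.trans_le hxy)
  have h1 := norm_add_add_norm_sub_le hne h
  have h2 : ‖h‖ ^ 2 / ‖x - y‖ ≤ ‖h‖ ^ 2 / r := by gcongr
  have e1 : x + h - y = x - y + h := by abel
  have e2 : x - h - y = x - y - h := by abel
  simp only [cone, e1, e2]
  have h3 := mul_le_mul_of_nonneg_left (h1.trans (add_le_add_right h2 _)) hb
  have e3 : b.1 / r * ‖h‖ ^ 2 = b.1 * (‖h‖ ^ 2 / r) := by ring
  rw [e3]
  linarith

/-- A cone of opening zero at a large height works. Nonemptiness keeps the `sInf` in `coneInf` from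
taking its default value. -/
theorem coneFamily_nonempty (hne : (frontier Ω).Nonempty) (hF : BddAbove (F '' frontier Ω))
    (hΨ : BddAbove (Ψ '' Ω)) : (coneFamily Ω F Ψ).Nonempty := by
  obtain ⟨y, hy⟩ := hne
  obtain ⟨M, hM⟩ := hF
  obtain ⟨N, hN⟩ := hΨ
  refine ⟨(y, (0, max M N)), hy, le_rfl, fun x hx => ?_, fun x hx => ?_⟩
  · simpa [cone] using Or.inl (hM (Set.mem_image_of_mem F hx))
  · simpa [cone] using Or.inr (hN (Set.mem_image_of_mem Ψ hx))

theorem le_coneInf_of_mem_frontier (hne : (coneFamily Ω F Ψ).Nonempty)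
    {x : EuclideanSpace ℝ (Fin d)} (hx : x ∈ frontier Ω) : F x ≤ coneInf Ω F Ψ x := by
  apply le_csInf (hne.image _)
  rintro _ ⟨k, hk, rfl⟩
  exact hk.2.2.1 x hx

theorem le_coneInf_of_mem (hne : (coneFamily Ω F Ψ).Nonempty)
    {x : EuclideanSpace ℝ (Fin d)} (hx : x ∈ Ω) : Ψ x ≤ coneInf Ω F Ψ x := by
  apply le_csInf (hne.image _)
  rintro _ ⟨k, hk, rfl⟩
  exact hk.2.2.2 x hx

theorem coneInf_le {k : EuclideanSpace ℝ (Fin d) × (ℝ × ℝ)} (hk : k ∈ coneFamily Ω F Ψ)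
    {x : EuclideanSpace ℝ (Fin d)} (hx : x ∈ Ω) : coneInf Ω F Ψ x ≤ cone k.1 k.2 x := by
  apply csInf_le _ (Set.mem_image_of_mem _ hk)
  refine ⟨Ψ x, ?_⟩
  rintro _ ⟨k, hk, rfl⟩
  exact hk.2.2.2 x hx

/-- The infimum of the cones is semiconcave at interior points: the openings of the cones which are
almost optimal at `x₀` are bounded, as their heights at the vertices are at least `F`. -/
theorem coneInf_add_coneInf_le (hne : (coneFamily Ω F Ψ).Nonempty)
    (hF : BddBelow (F '' frontier Ω)) (hΩ : IsOpen Ω)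
    {x₀ : EuclideanSpace ℝ (Fin d)} (hx₀ : x₀ ∈ Ω) :
    ∃ C : ℝ, ∀ᶠ h in 𝓝 (0 : EuclideanSpace ℝ (Fin d)),
      coneInf Ω F Ψ (x₀ + h) + coneInf Ω F Ψ (x₀ - h) ≤
        2 * coneInf Ω F Ψ x₀ + C * ‖h‖ ^ 2 := by
  obtain ⟨r, hr, hball⟩ := Metric.isOpen_iff.1 hΩ x₀ hx₀
  obtain ⟨m, hm⟩ := hF
  -- One factor `1 / r` bounds the opening, the other comes from `cone_add_cone_le`. The `1` is the
  -- cap on the optimality gap `min (ε / 2) 1`, which makes the constant independent of `ε`.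
  refine ⟨(coneInf Ω F Ψ x₀ + 1 - m) / r / r, ?_⟩
  filter_upwards [Metric.ball_mem_nhds 0 hr] with h hh
  rw [mem_ball_zero_iff] at hh
  have hadd : x₀ + h ∈ Ω := hball (by simpa [Metric.mem_ball, dist_eq_norm] using hh)
  have hsub : x₀ - h ∈ Ω := hball (by simpa [Metric.mem_ball, dist_eq_norm] using hh)
  refine le_of_forall_pos_lt_add fun ε hε => ?_
  have hδ : 0 < min (ε / 2) 1 := by positivity
  obtain ⟨_, ⟨k, hk, rfl⟩, hlt⟩ := exists_lt_of_csInf_lt (hne.image (fun k => cone k.1 k.2 x₀))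
    (lt_add_of_pos_right (coneInf Ω F Ψ x₀) hδ)
  simp only at hlt
  have hk0 := hk.2.1
  have hdist : r ≤ ‖x₀ - k.1‖ := by
    by_contra! hlt'
    have hmem : k.1 ∈ Ω := hball (by rwa [Metric.mem_ball, dist_comm, dist_eq_norm])
    exact (hΩ.frontier_eq ▸ hk.1 : k.1 ∈ closure Ω \ Ω).2 hmem
  have hvertex : m ≤ k.2.2 := by
    have h1 := hm (Set.mem_image_of_mem F hk.1)
    have h2 := hk.2.2.1 k.1 hk.1
    simp only [cone, sub_self, norm_zero, mul_zero, zero_add] at h2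
    exact h1.trans h2
  have hslope : k.2.1 ≤ (coneInf Ω F Ψ x₀ + 1 - m) / r := by
    rw [le_div_iff₀ hr]
    have h1 := mul_le_mul_of_nonneg_left hdist hk0
    have h2 : cone k.1 k.2 x₀ = k.2.1 * ‖x₀ - k.1‖ + k.2.2 := rfl
    linarith [min_le_right (ε / 2) 1]
  have h1 := cone_add_cone_le (h := h) hk0 hr hdist
  have h2 : k.2.1 / r * ‖h‖ ^ 2 ≤ (coneInf Ω F Ψ x₀ + 1 - m) / r / r * ‖h‖ ^ 2 := by gcongr
  linarith [coneInf_le hk hadd, coneInf_le hk hsub, min_le_left (ε / 2) 1]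

end ObstacleLimit

theorem mainTheorem8 {d : ℕ} (Ω : Set (EuclideanSpace ℝ (Fin d)))
    (hΩ : ObstacleLimit.IsBoundedSmoothDomain Ω)
    (F : EuclideanSpace ℝ (Fin d) → ℝ) (hF : ∃ L : ℝ≥0, LipschitzOnWith L F (frontier Ω))
    (Ψ : EuclideanSpace ℝ (Fin d) → ℝ) (hΨ : ContinuousOn Ψ (closure Ω))
    (hΨF : sSup (Ψ '' frontier Ω) < sInf (F '' frontier Ω))
    (hΨd : DifferentiableOn ℝ Ψ Ω)
    (u : EuclideanSpace ℝ (Fin d) → ℝ) (hu : ObstacleLimit.IsObstacleLimit Ω F Ψ u)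
    (huK : ∀ x ∈ closure Ω, u x = ObstacleLimit.coneInf Ω F Ψ x) :
    ∀ x₀ ∈ frontier {x | x ∈ closure Ω ∧ u x = Ψ x},
      DifferentiableAt ℝ u x₀ ∧ fderiv ℝ u x₀ = fderiv ℝ Ψ x₀ := by

  have hclosed : IsCompact (closure Ω) := hΩ.isBounded.isCompact_closure
  have hfr : IsCompact (frontier Ω) := hclosed.of_isClosed_subset isClosed_frontier
    frontier_subset_closure
  have hfne : (frontier Ω).Nonempty := by
    by_contra hne
    rw [Set.not_nonempty_iff_eq_empty] at hne
    -- Over the empty set `sSup` and `sInf` are both `0`, so `hΨF` would read `0 < 0`.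
    simp [hne] at hΨF
  obtain ⟨L, hL⟩ := hF
  have hFbdd := (hfr.image_of_continuousOn hL.continuousOn).isBounded
  have hΨbdd := (hclosed.image_of_continuousOn hΨ).isBounded.bddAbove
  have hne : (ObstacleLimit.coneFamily Ω F Ψ).Nonempty :=
    ObstacleLimit.coneFamily_nonempty hfne hFbdd.bddAbove
      (hΨbdd.mono (Set.image_mono subset_closure))
  -- Continuity makes the contact set closed, so its frontier points are contact points.
  have hucont : ContinuousOn u (closure Ω) := by
    obtain ⟨p, v, g, G, -, -, -, hv, hlim, -⟩ := hu
    exact hlim.continuousOn (Frequently.of_forall hv)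
  intro x₀ hx₀
  have hcontact : IsClosed {x | x ∈ closure Ω ∧ u x = Ψ x} := by
    have := (hucont.sub hΨ).preimage_isClosed_of_isClosed isClosed_closure
      (isClosed_singleton (x := (0 : ℝ)))
    convert this using 1
    ext x
    simp [sub_eq_zero]
  obtain ⟨hx₀cl, hx₀eq⟩ := hcontact.frontier_subset hx₀
  have hx₀Ω : x₀ ∈ Ω := by
    by_contra hnot
    have hx₀fr : x₀ ∈ frontier Ω := by
      rw [hΩ.isOpen.frontier_eq]
      exact ⟨hx₀cl, hnot⟩
    have h1 := ObstacleLimit.le_coneInf_of_mem_frontier hne hx₀fr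
    have h2 := csInf_le hFbdd.bddBelow (Set.mem_image_of_mem F hx₀fr)
    have h3 := le_csSup (hΨbdd.mono (Set.image_mono frontier_subset_closure))
      (Set.mem_image_of_mem Ψ hx₀fr)
    have h4 := huK x₀ hx₀cl
    linarith
  have hnhds : Ω ∈ 𝓝 x₀ := hΩ.isOpen.mem_nhds hx₀Ω
  have hueq : u =ᶠ[𝓝 x₀] ObstacleLimit.coneInf Ω F Ψ := by
    filter_upwards [hnhds] with x hx using huK x (subset_closure hx)
  obtain ⟨C, hC⟩ := ObstacleLimit.coneInf_add_coneInf_le hne hFbdd.bddBelow hΩ.isOpen hx₀Ω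
  have hder : HasFDerivAt u (fderiv ℝ Ψ x₀) x₀ := by
    refine HasFDerivAt.congr_of_eventuallyEq (ObstacleLimit.hasFDerivAt_of_touching_below
      (hΨd.differentiableAt hnhds).hasFDerivAt ?_ ?_ hC) hueq
    · rw [← hx₀eq, huK x₀ hx₀cl]
    · filter_upwards [hnhds] with x hx using ObstacleLimit.le_coneInf_of_mem hne hx
  exact ⟨hder.differentiableAt, hder.fderiv⟩
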